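/- \textbf{Setting.} Let $G$ be a complex semisimple linear algebraic group with maximal torus $T$, Borel subgroup $B\supseteq T$, root system $\Delta\subset\mathfrak t^*$, positive roots $\Delta^+$, simple roots $\alpha_1,\dots,\alpha_n$, simple reflections $s_1,\dots,s_n$, and Weyl group $W$. Let $P\supseteq B$ be the standard parabolic subgroup of a set $J$ of simple roots, $W_J=\langle s_j: j\in J\rangle$, and write $[w]\in W/W_J$ for the coset of $w$. Let $\ge$ be the Bruhat order on $W$ (subwords of reduced words), and let $[w]\ge_P[v]$ mean that $w'\ge v'$ for the minimal-length representatives $w'$ of $[w]$ and $v'$ of $[v]$. Let $\Delta_{\mathfrak n^-}$ be the set of negative roots that are not integral combinations of the $\alpha_j$ with $j\in J$. The \emph{moment graph} of $G/P$ has vertex set $W/W_J$. For $\alpha\in\Delta^+$ and $w \in W$ with $[s_\alpha w]\ne[w]$ and $w^{-1}(\alpha)\in\pm\Delta_{\mathfrak n^-}$ there is an edge labeled $\alpha$ between $[w]$ and $[s_\alpha w]$; it is directed $[w]\stackrel{\alpha}{\mapsto}[s_\alpha w]$ if $w^{-1}(\alpha)<0$, and $[s_\alpha w]\stackrel{\alpha}{\mapsto}[w]$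 otherwise. Vertices are ordered by $x\le y$ if a sequence of directed edges leads from $y$ to $x$. The equivariant cohomology with complex coefficients, in its Goresky--Kottwitz--MacPherson presentation, is \[H^*_T(G/P)=\{p: W/W_J\to S(\mathfrak t^*)\ :\ p(x)-p(y)\in\langle\alpha\rangle\text{ for every edge between } x \text{ and } y \text{ labeled }\alpha\}.\] A \emph{flow-up class} for a vertex $x$ is a $p_x\in H^*_T(G/P)$ such that (1) $p_x(y)\neq0$ if and only if $y\ge x$ in the moment graph; (2) $p_x$ is homogeneous, i.e. all the $p_x(y)$ are homogeneous of one common degree; (3) $p_x(x)=\prod\alpha$, the product over the labels $\alpha$ of the edges directed out of $x$. The group $W$ acts on functions $p:W/W_J\to S(\mathfrak t^*)$ by $(w\cdot p)([v])=w\big(p(w^{-1}[v])\big)$. \textbf{Lemma (formula for the action).} Let $p_{[w]}\in H^*_T(G/P)$ be a flow-up class for $[w]\in W/W_J$, let $s_i$ be a simple reflection, and, in the second case below, let $p_{[s_iw]}$ be a flow-up class for $[s_iw]$. Then \[s_i\cdot p_{[w]}=\begin{cases}p_{[w]} & \text{if } [s_iw]\ge_P[w],\\ p_{[w]}-\alpha_i\,p_{[s_iw]}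 & \text{if } [s_iw]<_P[w].\end{cases}\] -/

import Mathlib

/-!
The combinatorial data of a partial flag variety `G/P`: the root system of the complex semisimple
group `G` is a reduced crystallographic root system `R` over `ℂ` in `M = 𝔱*`, the Borel subgroup is
a base `b` of `R`, and the standard parabolic subgroup is a set `J` of simple roots.
-/

namespace FlagGKM

noncomputable section

variable {ι M N : Type*} [AddCommGroup M] [Module ℂ M] [AddCommGroup N] [Module ℂ N]

/-- The embedding of the linear forms `𝔱*` into the symmetric algebra `S(𝔱*)`. -/
abbrev lin (x : M) : SymmetricAlgebra ℂ M := SymmetricAlgebra.ι ℂ M x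

/-- The homogeneous elements of degree `d` in `S(𝔱*)`: the `ℂ`-span of the products of `d`
linear forms. -/
def homogeneousPart (M : Type*) [AddCommGroup M] [Module ℂ M] (d : ℕ) :
    Submodule ℂ (SymmetricAlgebra ℂ M) :=
  LinearMap.range (SymmetricAlgebra.ι ℂ M) ^ d

/-- The Weyl group element `w`, acting on `S(𝔱*)` as the `ℂ`-algebra homomorphism that extends
its action on `𝔱*`. -/
def symAct (R : RootPairing ι ℂ M N) (w : R.weylGroup) :
    SymmetricAlgebra ℂ M →ₐ[ℂ] SymmetricAlgebra ℂ M :=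
  SymmetricAlgebra.lift (SymmetricAlgebra.ι ℂ M ∘ₗ R.weylGroupRootRep w)

variable {R : RootPairing ι ℂ M N} (b : R.Base)

/-! ### The Weyl group: words, length, Bruhat order -/

/-- The simple reflection `s_i`. -/
def simpleReflection (i : b.support) : R.weylGroup :=
  RootPairing.weylGroup.ofIdx R i

/-- The product `s_{i₁} ⋯ s_{iₖ}` of a word in the simple reflections. -/
def wordProd (l : List b.support) : R.weylGroup :=
  (l.map (simpleReflection b)).prod

/-- The length `ℓ(w)`: the least number of letters of a word with product `w`. -/
def length (w : R.weylGroup) : ℕ :=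
  sInf {k | ∃ l : List b.support, wordProd b l = w ∧ l.length = k}

/-- The Bruhat order `v ≤ w` on `W`: some reduced word of `w` has a subword with product `v`. -/
def BruhatLE (v w : R.weylGroup) : Prop :=
  ∃ l : List b.support, wordProd b l = w ∧ l.length = length b w ∧
    ∃ l' : List b.support, l'.Sublist l ∧ wordProd b l' = v

/-- The parabolic subgroup `W_J`, generated by the simple reflections `s_j` with `j ∈ J`. -/
def parabolic (J : Set b.support) : Subgroup R.weylGroup :=
  Subgroup.closure (simpleReflection b '' J)

/-- The set `W/W_J` of left cosets. -/
abbrev Cosets (J : Set b.support) : Type _ := R.weylGroup ⧸ parabolic b J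

/-- `w` is an element of minimal length in its coset `[w] ∈ W/W_J`. -/
def IsMinRep (J : Set b.support) (w : R.weylGroup) : Prop :=
  ∀ u : R.weylGroup, (u : Cosets b J) = (w : Cosets b J) → length b w ≤ length b u

/-- The Bruhat order `x ≤_P y` on `W/W_J`: the Bruhat order on minimal-length representatives. -/
def BruhatLEP (J : Set b.support) (x y : Cosets b J) : Prop :=
  ∃ v w : R.weylGroup, (v : Cosets b J) = x ∧ (w : Cosets b J) = y ∧
    IsMinRep b J v ∧ IsMinRep b J w ∧ BruhatLE b v w

/-- The strict Bruhat order `x <_P y` on `W/W_J`. -/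
def BruhatLTP (J : Set b.support) (x y : Cosets b J) : Prop :=
  BruhatLEP b J x y ∧ x ≠ y

/-! ### The moment graph of `G/P` -/

/-- The set `Δ⁺` of positive roots. -/
def posRoots : Set M := {x | ∃ α : ι, b.IsPos α ∧ R.root α = x}

/-- The set `Δ_𝔩` of the roots that are integral combinations of the simple roots in `J`. -/
def leviRoots (J : Set b.support) : Set M :=
  {x | x ∈ Set.range R.root ∧ x ∈ AddSubgroup.closure ((fun j : b.support => R.root j) '' J)}

/-- The set `Δ_{𝔫⁻}` of the roots whose root space is not contained in `𝔭`, where the roots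
of `𝔭` are those in `Δ⁺ ∪ Δ_𝔩`. -/
def nMinusRoots (J : Set b.support) : Set M :=
  {x | x ∈ Set.range R.root ∧ x ∉ posRoots b ∪ leviRoots b J}

/-- The moment graph of `G/P` has an edge labeled by the positive root `α`, directed from `x`
to `y`: for some `w` one has `x = [w]`, `y = [s_α w] ≠ [w]`, `w⁻¹(α) ∈ ±Δ_{𝔫⁻}` and
`w⁻¹(α) < 0`. (If `w⁻¹(α) > 0`, the edge is directed from `[s_α w]` to `[w]`, and
this is the same condition with `s_α w` in place of `w`.) -/
def DirEdge (J : Set b.support) (x : Cosets b J) (α : ι) (y : Cosets b J) : Prop :=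
  b.IsPos α ∧ x ≠ y ∧ ∃ w : R.weylGroup,
    (w : Cosets b J) = x ∧
    ((RootPairing.weylGroup.ofIdx R α * w : R.weylGroup) : Cosets b J) = y ∧
    (w⁻¹ • R.root α ∈ nMinusRoots b J ∨ -(w⁻¹ • R.root α) ∈ nMinusRoots b J) ∧
    -(w⁻¹ • R.root α) ∈ posRoots b

/-- The partial order `x ≤ y` on the vertices of the moment graph: a sequence of directed edges
leads from `y` to `x`. -/
def GraphLE (J : Set b.support) (x y : Cosets b J) : Prop :=
  Relation.ReflTransGen (fun a c => ∃ α : ι, DirEdge b J a α c) y x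

/-- The labels of the edges that are directed out of the vertex `x`. -/
def outLabels (J : Set b.support) (x : Cosets b J) : Set ι :=
  {α | ∃ y : Cosets b J, DirEdge b J x α y}

/-! ### Equivariant cohomology and flow-up classes -/

/-- The equivariant cohomology ring `H*_T(G/P)` in its GKM presentation: all the functions
`p : W/W_J → S(𝔱*)` such that `p(x) - p(y)` lies in the ideal `(α)` for every edge of the moment
graph between `x` and `y` with label `α`, with coordinatewise operations, as an
`S(𝔱*)`-algebra. -/
def equivariantCohomology (J : Set b.support) :
    Subalgebra (SymmetricAlgebra ℂ M) (Cosets b J → SymmetricAlgebra ℂ M) where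
  carrier := {p | ∀ (x y : Cosets b J) (α : ι), DirEdge b J x α y →
    p x - p y ∈ Ideal.span {lin (R.root α)}}
  mul_mem' := by
    intro p q hp hq x y α h
    have e : (p * q) x - (p * q) y = p x * (q x - q y) + q y * (p x - p y) := by
      simp only [Pi.mul_apply]; ring
    rw [e]
    exact add_mem (Ideal.mul_mem_left _ _ (hq x y α h)) (Ideal.mul_mem_left _ _ (hp x y α h))
  add_mem' := by
    intro p q hp hq x y α h
    have e : (p + q) x - (p + q) y = (p x - p y) + (q x - q y) := by
      simp only [Pi.add_apply]; ring
    rw [e]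
    exact add_mem (hp x y α h) (hq x y α h)
  algebraMap_mem' := by
    intro c x y α _
    simp

/-- `p ∈ H*_T(G/P)` is a flow-up class corresponding to the vertex `x` of the moment graph. -/
structure IsFlowUp (J : Set b.support) (x : Cosets b J) (p : equivariantCohomology b J) :
    Prop where
  /-- `p` is supported exactly on the vertices `y ≥ x`. -/
  support : ∀ y : Cosets b J, p.1 y ≠ 0 ↔ GraphLE b J x y
  /-- `p` is homogeneous. -/
  homogeneous : ∃ d : ℕ, ∀ y : Cosets b J, p.1 y ∈ homogeneousPart M d
  /-- `p(x)` is the product of the labels of the edges directed out of `x`. -/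
  localization : p.1 x = ∏ᶠ α ∈ outLabels b J x, lin (R.root α)

/-- The action of `W` on functions `p : W/W_J → S(𝔱*)`, that is
`(w · p)([v]) = w (p (w⁻¹ [v]))`. -/
def weylAct (J : Set b.support) (w : R.weylGroup) (p : Cosets b J → SymmetricAlgebra ℂ M) :
    Cosets b J → SymmetricAlgebra ℂ M :=
  fun x => symAct R w (p (w⁻¹ • x))

end

end FlagGKM

/-! Let `ℓ(x)` be the number of edges directed out of `x`. It strictly drops along directed edges
and changes by at most one under `s_i`. A flow-up class `p` for `x` has degree `ℓ(x)`, and its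
support consists of `x` and vertices with larger `ℓ`.

The divided difference `g = (p - s_i p) / α_i` is again a GKM class (`exists_dividedDifference`),
and `α_i g` has degree `ℓ(x)`. At a vertex `y` of the support of a class with `ℓ(y)` minimal, the
outgoing labels, which are pairwise non-associate primes, all divide the value, so the degree there
is at least `ℓ(y)` (`prod_lin_dvd`). Hence a class of degree `ℓ(x) - 1` supported where `ℓ ≥ ℓ(x)`
vanishes (`eq_zero_of_support`).

If no edge goes from `x` to `s_i x`, this applies to `g` and gives `s_i p = p`. If there is such an
edge, only the vertex `s_i x` can violate the support bound. There `g` and the flow-up class `q` of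
`s_i x` agree by localization, so the vanishing applies to `g - q`.

The Bruhat hypotheses enter only through `not_bruhatLEP_of_dirEdge`, which fixes the direction of
the edge between `x` and `s_i x`. -/

namespace FlagGKM

noncomputable section

/-! ### Degree and primality of linear forms in `S(M)`. -/

section SymmetricAlgebra

variable {M : Type*} [AddCommGroup M] [Module ℂ M]

/-- The isomorphism of `S(M)` with a polynomial ring given by a basis of `M`. -/
def symEquiv (M : Type*) [AddCommGroup M] [Module ℂ M] :
    SymmetricAlgebra ℂ M ≃ₐ[ℂ] MvPolynomial (Module.Basis.ofVectorSpaceIndex ℂ M) ℂ :=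
  SymmetricAlgebra.equivMvPolynomial (Module.Basis.ofVectorSpace ℂ M)

/-- The total degree of an element of `S(M)`. -/
def symDegree (a : SymmetricAlgebra ℂ M) : ℕ := (symEquiv M a).totalDegree

lemma symDegree_mul {a c : SymmetricAlgebra ℂ M} (ha : a ≠ 0) (hc : c ≠ 0) :
    symDegree (a * c) = symDegree a + symDegree c := by
  rw [symDegree, map_mul, MvPolynomial.totalDegree_mul_of_isDomain (by simpa) (by simpa), symDegree, symDegree]

lemma isHomogeneous_symEquiv {d : ℕ} {a : SymmetricAlgebra ℂ M} (ha : a ∈ homogeneousPart M d) :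
    (symEquiv M a).IsHomogeneous d := by
  have hle : (LinearMap.range (SymmetricAlgebra.ι ℂ M)).map (symEquiv M).toLinearMap ≤
      MvPolynomial.homogeneousSubmodule _ ℂ 1 := by
    rw [← LinearMap.range_comp, LinearMap.range_eq_map, ← (Module.Basis.ofVectorSpace ℂ M).span_eq,
      Submodule.map_span, Submodule.span_le]
    rintro - ⟨-, ⟨k, rfl⟩, rfl⟩
    have : symEquiv M (SymmetricAlgebra.ι ℂ M (Module.Basis.ofVectorSpace ℂ M k)) =
        MvPolynomial.X k := SymmetricAlgebra.equivMvPolynomial_ι_apply _ k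
    change (symEquiv M (SymmetricAlgebra.ι ℂ M (Module.Basis.ofVectorSpace ℂ M k))).IsHomogeneous 1
    rw [this]
    exact MvPolynomial.isHomogeneous_X ℂ k
  have key : ∀ d : ℕ, (homogeneousPart M d).map (symEquiv M).toLinearMap ≤
      MvPolynomial.homogeneousSubmodule _ ℂ d := by
    intro d
    induction d with
    | zero =>
      rintro - ⟨a, ha, rfl⟩
      rw [homogeneousPart, pow_zero] at ha
      obtain ⟨c, rfl⟩ := Submodule.mem_one.mp ha
      simp [MvPolynomial.algebraMap_eq]
    | succ d ih =>
      have : (homogeneousPart M (d + 1)).map (symEquiv M).toLinearMap =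
          (homogeneousPart M d).map (symEquiv M).toLinearMap *
          (LinearMap.range (SymmetricAlgebra.ι ℂ M)).map (symEquiv M).toLinearMap := by
        rw [homogeneousPart, pow_succ]
        exact Submodule.map_mul _ _ (symEquiv M).toAlgHom
      rw [this]
      exact (mul_le_mul' ih hle).trans
        (Submodule.mul_le.mpr fun m hm n hn => MvPolynomial.IsHomogeneous.mul hm hn)
  exact key d ⟨a, ha, rfl⟩

/-- Nonvanishing matters: the zero element is homogeneous of every degree but has `symDegree` equal
to `0`. -/
lemma symDegree_eq_of_mem {d : ℕ} {a : SymmetricAlgebra ℂ M} (ha : a ∈ homogeneousPart M d)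
    (h0 : a ≠ 0) : symDegree a = d :=
  (isHomogeneous_symEquiv ha).totalDegree (by simpa)

lemma mul_mem_homogeneousPart {d e : ℕ} {a c : SymmetricAlgebra ℂ M}
    (ha : a ∈ homogeneousPart M d) (hc : c ∈ homogeneousPart M e) :
    a * c ∈ homogeneousPart M (d + e) := by
  rw [homogeneousPart, pow_add]
  exact Submodule.mul_mem_mul ha hc

lemma lin_mem_homogeneousPart (x : M) : lin x ∈ homogeneousPart M 1 := by
  simp [homogeneousPart]

lemma prod_lin_mem_homogeneousPart {κ : Type*} (s : Finset κ) (f : κ → M) :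
    ∏ k ∈ s, lin (f k) ∈ homogeneousPart M s.card := by
  classical
  induction s using Finset.induction_on with
  | empty => simp [homogeneousPart]
  | insert k s hk ih =>
    rw [Finset.prod_insert hk, Finset.card_insert_of_notMem hk, add_comm]
    exact mul_mem_homogeneousPart (lin_mem_homogeneousPart _) ih

lemma lin_ne_zero {x : M} (hx : x ≠ 0) : lin x ≠ 0 := by
  intro h
  obtain ⟨g, hg⟩ : ∃ g : Module.Dual ℂ M, g x ≠ 0 := by
    by_contra! hall
    exact hx ((Module.forall_dual_apply_eq_zero_iff ℂ x).mp hall)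
  apply hg
  rw [← SymmetricAlgebra.lift_ι_apply (f := g) x]
  exact (congrArg _ h).trans (map_zero _)

lemma symDegree_lin {x : M} (hx : x ≠ 0) : symDegree (lin x) = 1 :=
  symDegree_eq_of_mem (lin_mem_homogeneousPart x) (lin_ne_zero hx)

/-- Completing `x` to a basis of `M` turns `lin x` into a variable of a polynomial ring. -/
lemma prime_lin {x : M} (hx : x ≠ 0) : Prime (lin x) := by
  have hli : LinearIndepOn ℂ id ({x} : Set M) := LinearIndepOn.singleton hx
  let B := Module.Basis.extend hli
  have hB : B ⟨x, hli.subset_extend _ rfl⟩ = x := Module.Basis.extend_apply_self hli _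
  rw [← MulEquiv.prime_iff (SymmetricAlgebra.equivMvPolynomial B).toMulEquiv]
  have : SymmetricAlgebra.equivMvPolynomial B (lin x) =
      MvPolynomial.X ⟨x, hli.subset_extend _ rfl⟩ := by
    rw [← SymmetricAlgebra.equivMvPolynomial_ι_apply B, hB]
  change Prime (SymmetricAlgebra.equivMvPolynomial B (lin x))
  rw [this]
  exact MvPolynomial.X_prime

/-- The map to the symmetric algebra of `M / ⟨x⟩` kills `lin x`, hence also `lin y`. -/
lemma mem_span_of_lin_dvd_lin {x y : M} (h : lin x ∣ lin y) : y ∈ Submodule.span ℂ {x} := by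
  let f : SymmetricAlgebra ℂ M →ₐ[ℂ] SymmetricAlgebra ℂ (M ⧸ Submodule.span ℂ {x}) :=
    SymmetricAlgebra.lift (SymmetricAlgebra.ι ℂ _ ∘ₗ (Submodule.span ℂ {x}).mkQ)
  have hf : ∀ z, f (lin z) = lin ((Submodule.span ℂ {x}).mkQ z) := fun z =>
    SymmetricAlgebra.lift_ι_apply _ z
  have h1 := map_dvd f h
  have hx0 : (Submodule.span ℂ {x}).mkQ x = 0 := by
    simp [Submodule.mem_span_singleton_self]
  rw [hf, hf, hx0, lin, map_zero, zero_dvd_iff] at h1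
  by_contra hy
  exact lin_ne_zero (by simpa using hy) h1

end SymmetricAlgebra

/-! ### Reflections in the Weyl group and signs of roots. -/

section Roots

variable {ι M N : Type*} [AddCommGroup M] [Module ℂ M] [AddCommGroup N] [Module ℂ N]
  {R : RootPairing ι ℂ M N}

lemma ofIdx_smul_eq (α : ι) (x : M) :
    RootPairing.weylGroup.ofIdx R α • x = R.reflection α x := rfl

lemma weylGroup_ext {v w : R.weylGroup} (h : ∀ x : M, v • x = w • x) : v = w :=
  Subtype.ext (RootPairing.Equiv.weightHom_injective R (LinearEquiv.ext h))

lemma ofIdx_mul_self (α : ι) :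
    RootPairing.weylGroup.ofIdx R α * RootPairing.weylGroup.ofIdx R α = 1 :=
  weylGroup_ext fun x => by simp [mul_smul]

lemma ofIdx_inv (α : ι) :
    (RootPairing.weylGroup.ofIdx R α)⁻¹ = RootPairing.weylGroup.ofIdx R α :=
  inv_eq_of_mul_eq_one_left (ofIdx_mul_self α)

lemma ofIdx_neg (α : ι) :
    RootPairing.weylGroup.ofIdx R (R.reflectionPerm α α) = RootPairing.weylGroup.ofIdx R α :=
  weylGroup_ext fun x => by simp [RootPairing.reflection_reflectionPerm]

lemma ofIdx_reflectionPerm (α β : ι) :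
    RootPairing.weylGroup.ofIdx R (R.reflectionPerm β α) =
      RootPairing.weylGroup.ofIdx R β * RootPairing.weylGroup.ofIdx R α *
        RootPairing.weylGroup.ofIdx R β :=
  weylGroup_ext fun x => by
    simp [mul_smul, RootPairing.reflection_reflectionPerm]

lemma root_neg (α : ι) : R.root (R.reflectionPerm α α) = -R.root α := by
  simp [RootPairing.root_reflectionPerm]

lemma ofIdx_conj (w : R.weylGroup) :
    ∀ α β : ι, R.root β = w • R.root α →
      RootPairing.weylGroup.ofIdx R β = w * RootPairing.weylGroup.ofIdx R α * w⁻¹ := by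
  obtain ⟨w, hw⟩ := w
  induction hw using RootPairing.weylGroup.induction with
  | mem i =>
    intro α β h
    have h' : β = R.reflectionPerm i α := by
      apply R.root.injective
      rw [h, RootPairing.root_reflectionPerm]
      rfl
    rw [h', ofIdx_reflectionPerm]
    change _ = RootPairing.weylGroup.ofIdx R i * _ * (RootPairing.weylGroup.ofIdx R i)⁻¹
    rw [ofIdx_inv]
  | one =>
    intro α β h
    have h' : β = α := R.root.injective (h.trans (one_smul _ _))
    subst h'
    change _ = 1 * _ * 1⁻¹
    simp
  | mul v w hv hw ihv ihw =>
    intro α β h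
    set v' : R.weylGroup := ⟨v, hv⟩
    set w' : R.weylGroup := ⟨w, hw⟩
    change R.root β = (v' * w') • R.root α at h
    rw [mul_smul, R.weylGroup_apply_root w'] at h
    change _ = (v' * w') * _ * (v' * w')⁻¹
    rw [ihv _ _ h, ihw _ _ (R.weylGroup_apply_root w' α).symm]
    group

variable {b : R.Base} {J : Set b.support}

lemma isPos_neg_iff {α : ι} : b.IsPos (R.reflectionPerm α α) ↔ ¬ b.IsPos α :=
  RootPairing.Base.IsPos.neg_iff_not b α

lemma root_mem_posRoots_iff {α : ι} : R.root α ∈ posRoots b ↔ b.IsPos α :=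
  ⟨fun ⟨_, hβ, h⟩ => R.root.injective h ▸ hβ, fun h => ⟨α, h, rfl⟩⟩

lemma neg_root_mem_posRoots_iff {α : ι} : -R.root α ∈ posRoots b ↔ ¬ b.IsPos α := by
  rw [← root_neg, root_mem_posRoots_iff, isPos_neg_iff]

/-! ### The height outside `J`, which detects the Levi roots and `Δ_{𝔫⁻}`. -/

variable [R.IsRootSystem]

variable (b J)

open Classical in
/-- The linear form that is `0` on the simple roots in `J` and `1` on the other ones. -/
def outerForm : M →ₗ[ℂ] ℂ :=
  b.toWeightBasis.constr ℂ fun k => if k ∈ J then 0 else 1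

/-- The sum of the coefficients at the simple roots outside `J`. -/
def outerHeight : M →+ ℝ :=
  Complex.reAddGroupHom.comp (outerForm b J).toAddMonoidHom

variable {b J}

lemma outerForm_simple_mem {k : b.support} (hk : k ∈ J) : outerForm b J (R.root k) = 0 := by
  rw [← b.toWeightBasis_apply, outerForm, Module.Basis.constr_basis, if_pos hk]

lemma outerForm_simple_notMem {k : b.support} (hk : k ∉ J) : outerForm b J (R.root k) = 1 := by
  rw [← b.toWeightBasis_apply, outerForm, Module.Basis.constr_basis, if_neg hk]

lemma outerHeight_apply (x : M) : outerHeight b J x = (outerForm b J x).re := rfl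

/-- For `j ∈ J`, `s_j` changes a vector by a multiple of `α_j`, on which the form vanishes. This
invariance lets heights descend to `W/W_J`. -/
lemma outerHeight_smul_of_mem {u : R.weylGroup} (hu : u ∈ parabolic b J) (x : M) :
    outerHeight b J (u • x) = outerHeight b J x := by
  induction hu using Subgroup.closure_induction generalizing x with
  | mem u hu =>
    obtain ⟨j, hj, rfl⟩ := hu
    rw [simpleReflection, ofIdx_smul_eq, R.reflection_apply, outerHeight_apply, map_sub, map_smul,
      outerForm_simple_mem hj]
    simp [outerHeight_apply]
  | one => rw [one_smul]
  | mul u v _ _ ihu ihv => rw [mul_smul, ihu, ihv]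
  | inv u _ ih => rw [← ih, smul_inv_smul]

lemma outerHeight_eq_zero_of_mem {x : M}
    (hx : x ∈ AddSubgroup.closure ((fun j : b.support => R.root j) '' J)) :
    outerHeight b J x = 0 := by
  induction hx using AddSubgroup.closure_induction with
  | mem x hx =>
    obtain ⟨j, hj, rfl⟩ := hx
    simp [outerHeight_apply, outerForm_simple_mem hj]
  | zero => simp
  | add x y _ _ hx hy => simp [hx, hy]
  | neg x _ hx => simp [hx]

variable [Finite ι] [R.IsCrystallographic]

/-- Positive roots are built by adding simple roots one at a time; a sum of nonnegative heights is
zero only if every summand is. -/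
lemma isPos_outerHeight {α : ι} (hα : b.IsPos α) :
    0 ≤ outerHeight b J (R.root α) ∧ (outerHeight b J (R.root α) = 0 →
      R.root α ∈ AddSubgroup.closure ((fun j : b.support => R.root j) '' J)) := by
  have hs : ∀ k ∈ b.support, 0 ≤ outerHeight b J (R.root k) ∧ (outerHeight b J (R.root k) = 0 →
      R.root k ∈ AddSubgroup.closure ((fun j : b.support => R.root j) '' J)) := by
    intro k hk
    by_cases hJ : (⟨k, hk⟩ : b.support) ∈ J
    · refine ⟨?_, fun _ => AddSubgroup.subset_closure ⟨_, hJ, rfl⟩⟩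
      rw [outerHeight_apply, outerForm_simple_mem hJ, Complex.zero_re]
    · have := outerForm_simple_notMem hJ
      simp only at this
      rw [outerHeight_apply, this]
      simp
  refine hα.induction_on_add hs fun β k γ h ⟨h1, h2⟩ hk => ?_
  obtain ⟨h3, h4⟩ := hs k hk
  rw [h, map_add]
  exact ⟨add_nonneg h1 h3, fun h0 => add_mem (h2 (by linarith)) (h4 (by linarith))⟩

lemma not_isPos_outerHeight {α : ι} (hα : ¬ b.IsPos α) :
    outerHeight b J (R.root α) ≤ 0 := by
  have := (isPos_outerHeight (J := J) (isPos_neg_iff.mpr hα)).1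
  rw [root_neg, map_neg] at this
  linarith

lemma isPos_of_outerHeight_pos {α : ι} (h : 0 < outerHeight b J (R.root α)) : b.IsPos α := by
  by_contra hα
  exact absurd (not_isPos_outerHeight (J := J) hα) (not_le.mpr h)

lemma root_mem_nMinusRoots_iff {α : ι} :
    R.root α ∈ nMinusRoots b J ↔ outerHeight b J (R.root α) < 0 := by
  simp only [nMinusRoots, leviRoots, Set.mem_ofPred_eq, Set.mem_range_self, true_and,
    Set.mem_union, root_mem_posRoots_iff, not_or]
  constructor
  · rintro ⟨h1, h2⟩
    refine lt_of_le_of_ne (not_isPos_outerHeight h1) fun h0 => h2 ?_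
    have := (isPos_outerHeight (J := J) (isPos_neg_iff.mpr h1)).2
    rw [root_neg, map_neg, h0, neg_zero, neg_mem_iff] at this
    exact this rfl
  · intro h
    exact ⟨fun hα => absurd (isPos_outerHeight (J := J) hα).1 (not_le.mpr h),
      fun hα => h.ne (outerHeight_eq_zero_of_mem hα)⟩

lemma neg_root_mem_nMinusRoots_iff {α : ι} :
    -R.root α ∈ nMinusRoots b J ↔ 0 < outerHeight b J (R.root α) := by
  rw [← root_neg, root_mem_nMinusRoots_iff, root_neg, map_neg, neg_lt_zero]

variable [R.IsReduced]

/-- The reflections in the roots of the Levi subgroup lie in `W_J`. -/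
lemma ofIdx_mem_parabolic {α : ι} (h : outerHeight b J (R.root α) = 0) :
    RootPairing.weylGroup.ofIdx R α ∈ parabolic b J := by
  wlog hα : b.IsPos α generalizing α
  · rw [← ofIdx_neg]
    exact this (by rw [root_neg, map_neg, h, neg_zero]) (isPos_neg_iff.mpr hα)
  generalize hn : (b.height α).toNat = n
  induction n using Nat.strong_induction_on generalizing α with
  | _ n ih =>
    -- Reflecting in a simple root that pairs positively with `α` lowers the height, and conjugating
    -- by `s_j` reduces `s_α` to a reflection in a root of smaller height.
    obtain ⟨j, hj, hpos⟩ := hα.exists_mem_support_pos_pairingIn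
    rw [R.zero_lt_pairingIn_iff'] at hpos
    have hrefl : R.root (R.reflectionPerm j α) =
        R.root α + (-R.pairingIn ℤ α j) • R.root j := by
      rw [RootPairing.root_reflectionPerm, neg_smul, RootPairing.reflection_apply_root' ℤ,
        sub_eq_add_neg]
    rcases eq_or_ne α j with rfl | hαj
    · by_cases hJ : (⟨α, hj⟩ : b.support) ∈ J
      · exact Subgroup.subset_closure ⟨_, hJ, rfl⟩
      · have := outerForm_simple_notMem hJ
        simp only at this
        simp [outerHeight_apply, this] at h
    · have hk := hα.reflectionPerm hj hαj
      by_cases hJ : (⟨j, hj⟩ : b.support) ∈ J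
      · have hjm : RootPairing.weylGroup.ofIdx R j ∈ parabolic b J :=
          Subgroup.subset_closure ⟨⟨j, hj⟩, hJ, rfl⟩
        have h0 : outerHeight b J (R.root (R.reflectionPerm j α)) = 0 := by
          rw [RootPairing.root_reflectionPerm, ← ofIdx_smul_eq, outerHeight_smul_of_mem hjm, h]
        have hlt : b.height (R.reflectionPerm j α) < b.height α := by
          rw [b.height_add_zsmul hrefl, RootPairing.Base.height_one_of_mem_support hj]
          simpa using hpos
        have hmem := ih _ (by rw [RootPairing.Base.isPos_iff] at hk hα; omega) h0 hk rfl
        have e : α = R.reflectionPerm j (R.reflectionPerm j α) := by simp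
        rw [e, ofIdx_reflectionPerm]
        exact mul_mem (mul_mem hjm hmem) hjm
      -- Impossible case: for `j ∉ J` the positive root `s_j α` would have outer height minus the
      -- pairing, which is negative.
      · have hle := (isPos_outerHeight (J := J) hk).1
        have := outerForm_simple_notMem hJ
        simp only at this
        rw [hrefl, map_add, map_zsmul, h, outerHeight_apply, this] at hle
        have : (0 : ℝ) < R.pairingIn ℤ α j := by exact_mod_cast hpos
        simp at hle
        linarith

end Roots

/-! ### The moment graph: directions, outgoing edges, and the Bruhat order. -/

section Graph

variable {ι M N : Type*} [AddCommGroup M] [Module ℂ M] [AddCommGroup N] [Module ℂ N]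
  {R : RootPairing ι ℂ M N} {b : R.Base} {J : Set b.support}

lemma simple_isPos (i : b.support) : b.IsPos i := RootPairing.Base.isPos_of_mem_support i.2

lemma simpleReflection_inv (i : b.support) : (simpleReflection b i)⁻¹ = simpleReflection b i :=
  ofIdx_inv _

lemma simpleReflection_smul_smul (i : b.support) (x : Cosets b J) :
    simpleReflection b i • simpleReflection b i • x = x := by
  rw [← mul_smul, simpleReflection, ofIdx_mul_self, one_smul]

/-- A form of the exchange property: `α` is moved past the letters one by one. A simple reflection
keeps a positive root positive unless it is its own simple root, so `α` must meet its own letter,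
and that letter is deleted. -/
lemma exists_shorter_word [Finite ι] [R.IsCrystallographic] [R.IsReduced] (l : List b.support)
    {α : ι} (hα : b.IsPos α) (h : (wordProd b l)⁻¹ • R.root α ∉ posRoots b) :
    ∃ l' : List b.support, l'.length < l.length ∧
      wordProd b l' = RootPairing.weylGroup.ofIdx R α * wordProd b l := by
  induction l generalizing α with
  | nil => simp [wordProd, root_mem_posRoots_iff, hα] at h
  | cons j l ih =>
    have hw : wordProd b (j :: l) = RootPairing.weylGroup.ofIdx R j * wordProd b l := by
      simp [wordProd, simpleReflection]
    by_cases hαj : α = j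
    · refine ⟨l, by simp, ?_⟩
      rw [hw, hαj, ← mul_assoc, ofIdx_mul_self, one_mul]
    · have hr : R.root (R.reflectionPerm j α) = RootPairing.weylGroup.ofIdx R j • R.root α :=
        RootPairing.root_reflectionPerm R j α
      obtain ⟨l', hlen, hl'⟩ := ih (hα.reflectionPerm j.2 hαj) (by
        rwa [hr, ← mul_smul, ← ofIdx_inv, ← mul_inv_rev, ← hw])
      refine ⟨j :: l', by simpa using hlen, ?_⟩
      have hw' : wordProd b (j :: l') = RootPairing.weylGroup.ofIdx R j * wordProd b l' := by
        simp [wordProd, simpleReflection]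
      rw [hw', hl', hw, ofIdx_reflectionPerm]
      simp only [← mul_assoc, ofIdx_mul_self, one_mul]

variable [R.IsRootSystem]

variable (b J) in
/-- The function `m ↦ outerHeight (w⁻¹ m)` for the vertex `x = [w]`. -/
def cosetHeight (x : Cosets b J) : M →+ ℝ :=
  (outerHeight b J).comp (DistribSMul.toAddMonoidHom M x.out⁻¹)

lemma cosetHeight_mk (w : R.weylGroup) (m : M) :
    cosetHeight b J (w : Cosets b J) m = outerHeight b J (w⁻¹ • m) := by
  obtain ⟨u, hu⟩ := QuotientGroup.mk_out_eq_mul (parabolic b J) w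
  change outerHeight b J ((w : Cosets b J).out⁻¹ • m) = _
  rw [hu, mul_inv_rev, mul_smul, outerHeight_smul_of_mem (inv_mem u.2)]

lemma cosetHeight_smul (w : R.weylGroup) (x : Cosets b J) (m : M) :
    cosetHeight b J (w • x) m = cosetHeight b J x (w⁻¹ • m) := by
  obtain ⟨v, rfl⟩ := QuotientGroup.mk_surjective x
  change cosetHeight b J ((w * v : R.weylGroup) : Cosets b J) m = _
  rw [cosetHeight_mk, cosetHeight_mk, mul_inv_rev, mul_smul]

lemma cosetHeight_ofIdx_smul (α : ι) (x : Cosets b J) (m : M) :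
    cosetHeight b J (RootPairing.weylGroup.ofIdx R α • x) m =
      cosetHeight b J x (R.reflection α m) := by
  rw [cosetHeight_smul, ofIdx_inv, ofIdx_smul_eq]

variable [Finite ι] [R.IsCrystallographic] [R.IsReduced]

lemma ofIdx_smul_coset_eq {x : Cosets b J} {α : ι} (h : cosetHeight b J x (R.root α) = 0) :
    RootPairing.weylGroup.ofIdx R α • x = x := by
  obtain ⟨w, rfl⟩ := QuotientGroup.mk_surjective x
  change cosetHeight b J (w : Cosets b J) _ = 0 at h
  rw [cosetHeight_mk, R.weylGroup_apply_root w⁻¹] at h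
  have hc := ofIdx_conj w⁻¹ _ _ (R.weylGroup_apply_root w⁻¹ α).symm
  refine (QuotientGroup.eq.mpr ?_).symm
  have := ofIdx_mem_parabolic h
  rwa [hc, inv_inv, mul_assoc] at this

/-- Edges become a sign condition independent of the representative. The endpoints differ
automatically, because `s_α` reverses the sign of the height of `α`. -/
lemma dirEdge_iff {x y : Cosets b J} {α : ι} :
    DirEdge b J x α y ↔ b.IsPos α ∧ cosetHeight b J x (R.root α) < 0 ∧
      y = RootPairing.weylGroup.ofIdx R α • x := by
  constructor
  · rintro ⟨hα, -, w, rfl, rfl, hn, hneg⟩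
    refine ⟨hα, ?_, rfl⟩
    rw [cosetHeight_mk]
    rw [R.weylGroup_apply_root w⁻¹] at hn hneg ⊢
    rw [neg_root_mem_posRoots_iff] at hneg
    rw [root_mem_nMinusRoots_iff, neg_root_mem_nMinusRoots_iff] at hn
    exact hn.resolve_right fun h => hneg (isPos_of_outerHeight_pos h)
  · rintro ⟨hα, hx, rfl⟩
    refine ⟨hα, fun h => ?_, ?_⟩
    · have := cosetHeight_ofIdx_smul α x (R.root α)
      rw [← h, R.reflection_apply_self, map_neg] at this
      linarith
    · obtain ⟨w, rfl⟩ := QuotientGroup.mk_surjective x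
      change cosetHeight b J (w : Cosets b J) _ < 0 at hx
      rw [cosetHeight_mk] at hx
      refine ⟨w, rfl, rfl, Or.inl ?_, ?_⟩
      · rw [R.weylGroup_apply_root w⁻¹] at hx ⊢
        rwa [root_mem_nMinusRoots_iff]
      · rw [R.weylGroup_apply_root w⁻¹] at hx ⊢
        rw [neg_root_mem_posRoots_iff]
        exact fun h => absurd (isPos_outerHeight h).1 (not_le.mpr hx)

lemma mem_outLabels_iff {x : Cosets b J} {α : ι} :
    α ∈ outLabels b J x ↔ b.IsPos α ∧ cosetHeight b J x (R.root α) < 0 :=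
  ⟨fun ⟨_, h⟩ => ⟨(dirEdge_iff.mp h).1, (dirEdge_iff.mp h).2.1⟩,
    fun h => ⟨_, dirEdge_iff.mpr ⟨h.1, h.2, rfl⟩⟩⟩

/-- The number of edges directed out of a vertex strictly decreases along directed edges. -/
lemma ncard_outLabels_lt {x y : Cosets b J} {α : ι} (h : DirEdge b J x α y) :
    (outLabels b J y).ncard < (outLabels b J x).ncard := by
  classical
  have hαx : α ∈ outLabels b J x := ⟨y, h⟩
  obtain ⟨hα, hx, rfl⟩ := dirEdge_iff.mp h
  have hmem : ∀ β ∈ outLabels b J (RootPairing.weylGroup.ofIdx R α • x),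
      b.IsPos β ∧ cosetHeight b J x (R.root (R.reflectionPerm α β)) < 0 := by
    intro β hβ
    rw [mem_outLabels_iff, cosetHeight_ofIdx_smul] at hβ
    rwa [RootPairing.root_reflectionPerm]
  refine lt_of_le_of_lt ?_ (Set.ncard_sdiff_singleton_lt_of_mem hαx)
  -- Each label `β` goes to whichever of `s_α β` and `β` is needed to stay positive. If `s_α β` is
  -- not positive, then `β` pairs positively with `α`, and `β` itself has negative height at `x`.
  refine Set.ncard_le_ncard_of_injOn
    (fun β => if b.IsPos (R.reflectionPerm α β) then R.reflectionPerm α β else β) ?_ ?_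
  · intro β hβ
    obtain ⟨hβ, hneg⟩ := hmem β hβ
    split_ifs with hp
    · refine ⟨mem_outLabels_iff.mpr ⟨hp, hneg⟩, fun he => ?_⟩
      have hβ' : β = R.reflectionPerm α α := by
        rw [← (R.reflectionPerm α).injective.eq_iff, Set.mem_singleton_iff.mp he]; simp
      rw [hβ', isPos_neg_iff] at hβ
      exact hβ hα
    · have hrefl : R.root (R.reflectionPerm α β) =
          R.root β + (-R.pairingIn ℤ β α) • R.root α := by
        rw [RootPairing.root_reflectionPerm, neg_smul, RootPairing.reflection_apply_root' ℤ,
          sub_eq_add_neg]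
      have hc : 0 < R.pairingIn ℤ β α := by
        by_contra! hc
        refine hp ?_
        rw [RootPairing.Base.isPos_iff] at hβ hα ⊢
        rw [b.height_add_zsmul hrefl, smul_eq_mul]
        nlinarith
      refine ⟨mem_outLabels_iff.mpr ⟨hβ, ?_⟩, fun he => ?_⟩
      · have hc' : (0 : ℝ) < R.pairingIn ℤ β α := by exact_mod_cast hc
        rw [hrefl, map_add, map_zsmul, zsmul_eq_mul] at hneg
        push_cast at hneg
        nlinarith
      · rw [Set.mem_singleton_iff.mp he, root_neg, map_neg] at hneg
        linarith
  · intro β hβ γ hγ he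
    have hβ := (hmem β hβ).1
    have hγ := (hmem γ hγ).1
    dsimp only at he
    split_ifs at he with h1 h2 h2
    · exact (R.reflectionPerm α).injective he
    · rw [← he] at h2
      simp [hβ] at h2
    · rw [he] at h1
      simp [hγ] at h1
    · exact he

lemma ncard_outLabels_le {x y : Cosets b J} (h : GraphLE b J x y) :
    x = y ∨ (outLabels b J x).ncard < (outLabels b J y).ncard := by
  induction h with
  | refl => exact Or.inl rfl
  | tail _ he ih =>
    obtain ⟨α, he⟩ := he
    have := ncard_outLabels_lt he
    rcases ih with rfl | ih
    · exact Or.inr this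
    · exact Or.inr (this.trans ih)

/-- `s_i` permutes the positive roots other than `α_i`, so outgoing edges at `x` and `s_i x`
correspond except for the label `α_i`. -/
lemma reflectionPerm_mem_outLabels {x : Cosets b J} {i : b.support} {α : ι}
    (h : α ∈ outLabels b J x \ {(i : ι)}) :
    R.reflectionPerm i α ∈ outLabels b J (simpleReflection b i • x) \ {(i : ι)} := by
  obtain ⟨hα, hi⟩ := h
  obtain ⟨hp, hneg⟩ := mem_outLabels_iff.mp hα
  have hk := hp.reflectionPerm i.2 hi
  refine ⟨mem_outLabels_iff.mpr ⟨hk, ?_⟩, fun he => ?_⟩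
  · rw [simpleReflection, cosetHeight_ofIdx_smul, ← RootPairing.root_reflectionPerm]
    simpa using hneg
  · have hα' : α = R.reflectionPerm i i := by
      rw [← (R.reflectionPerm (i : ι)).injective.eq_iff, Set.mem_singleton_iff.mp he]; simp
    rw [hα', isPos_neg_iff] at hp
    exact hp (simple_isPos i)

lemma outLabels_simpleReflection_smul (x : Cosets b J) (i : b.support) :
    outLabels b J (simpleReflection b i • x) \ {(i : ι)} =
      R.reflectionPerm i '' (outLabels b J x \ {(i : ι)}) := by
  ext α
  constructor
  · intro h
    have := reflectionPerm_mem_outLabels h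
    rw [simpleReflection_smul_smul] at this
    exact ⟨_, this, by simp⟩
  · rintro ⟨β, hβ, rfl⟩
    exact reflectionPerm_mem_outLabels hβ

lemma ncard_outLabels_diff (x : Cosets b J) (i : b.support) :
    (outLabels b J (simpleReflection b i • x) \ {(i : ι)}).ncard =
      (outLabels b J x \ {(i : ι)}).ncard := by
  rw [outLabels_simpleReflection_smul, Set.ncard_image_of_injective _ (Equiv.injective _)]

lemma ncard_outLabels_le_add_one (x : Cosets b J) (i : b.support) :
    (outLabels b J x).ncard ≤ (outLabels b J (simpleReflection b i • x)).ncard + 1 := by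
  calc (outLabels b J x).ncard ≤ (outLabels b J x \ {(i : ι)}).ncard + 1 := by
        simpa using Set.ncard_le_ncard_sdiff_add_ncard (outLabels b J x) {(i : ι)}
    _ ≤ _ := by
        rw [← ncard_outLabels_diff]
        exact Nat.add_le_add_right (Set.ncard_le_ncard Set.sdiff_subset) 1

lemma dirEdge_or_dirEdge {x : Cosets b J} {i : b.support} (h : simpleReflection b i • x ≠ x) :
    DirEdge b J x i (simpleReflection b i • x) ∨ DirEdge b J (simpleReflection b i • x) i x := by
  rcases lt_trichotomy (cosetHeight b J x (R.root i)) 0 with h0 | h0 | h0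
  · exact Or.inl (dirEdge_iff.mpr ⟨simple_isPos i, h0, rfl⟩)
  · exact absurd (ofIdx_smul_coset_eq h0) h
  · refine Or.inr (dirEdge_iff.mpr ⟨simple_isPos i, ?_, ?_⟩)
    · rw [simpleReflection, cosetHeight_ofIdx_smul, R.reflection_apply_self, map_neg]
      linarith
    · exact (simpleReflection_smul_smul i x).symm

/-- Directed edges go down in the Bruhat order on minimal representatives. -/
lemma not_bruhatLEP_of_dirEdge {x y : Cosets b J} {α : ι} (h : DirEdge b J x α y) :
    ¬ BruhatLEP b J x y := by
  rintro ⟨v, w, rfl, rfl, -, hw, l, hl, hlen, l', hsub, hl'⟩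
  obtain ⟨hα, hx, hy⟩ := dirEdge_iff.mp h
  rw [cosetHeight_mk] at hx
  have hv : v⁻¹ • R.root α ∉ posRoots b := by
    rw [R.weylGroup_apply_root v⁻¹] at hx ⊢
    rw [root_mem_posRoots_iff]
    exact fun h => absurd (isPos_outerHeight h).1 (not_le.mpr hx)
  rw [← hl'] at hv
  -- The subword representing `v` can be shortened to a word for `s_α v`, which lies in the coset of
  -- `w` and is then shorter than the minimal representative `w`.
  obtain ⟨l'', hlt, hl''⟩ := exists_shorter_word l' hα hv
  have h1 := hw (wordProd b l'') (by rw [hl'', hl', hy]; rfl)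
  have h2 : length b (wordProd b l'') ≤ l''.length := Nat.sInf_le ⟨l'', rfl, rfl⟩
  have h3 := hsub.length_le
  omega

end Graph

/-! ### The Weyl group action, divided differences, and vanishing of low-degree classes. -/

section WeylAction

variable {ι M N : Type*} [AddCommGroup M] [Module ℂ M] [AddCommGroup N] [Module ℂ N]
  {R : RootPairing ι ℂ M N} {b : R.Base} {J : Set b.support}

lemma symAct_lin (w : R.weylGroup) (x : M) : symAct R w (lin x) = lin (w • x) :=
  SymmetricAlgebra.lift_ι_apply _ x

lemma symAct_mem_homogeneousPart (w : R.weylGroup) {d : ℕ} {a : SymmetricAlgebra ℂ M}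
    (ha : a ∈ homogeneousPart M d) : symAct R w a ∈ homogeneousPart M d := by
  have h : (homogeneousPart M d).map (symAct R w).toLinearMap ≤ homogeneousPart M d := by
    rw [homogeneousPart, Submodule.map_pow]
    refine pow_le_pow_left' ?_ d
    rintro - ⟨-, ⟨x, rfl⟩, rfl⟩
    exact ⟨w • x, (symAct_lin w x).symm⟩
  exact h ⟨a, ha, rfl⟩

lemma symAct_simpleReflection_self (i : b.support) (a : SymmetricAlgebra ℂ M) :
    symAct R (simpleReflection b i) (symAct R (simpleReflection b i) a) = a := by
  have : (symAct R (simpleReflection b i)).comp (symAct R (simpleReflection b i)) =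
      AlgHom.id ℂ (SymmetricAlgebra ℂ M) := by
    refine SymmetricAlgebra.algHom_ext (LinearMap.ext fun x => ?_)
    change symAct R _ (symAct R _ (lin x)) = lin x
    rw [symAct_lin, symAct_lin, ← mul_smul, simpleReflection, ofIdx_mul_self, one_smul]
  exact DFunLike.congr_fun this a

lemma symAct_simpleReflection_lin_root (i : b.support) (α : ι) :
    symAct R (simpleReflection b i) (lin (R.root α)) = lin (R.root (R.reflectionPerm i α)) := by
  rw [symAct_lin, RootPairing.root_reflectionPerm]
  rfl

/-- `s_i` acts trivially modulo `α_i` on linear forms, hence on all of `S(𝔱*)`. -/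
lemma lin_root_dvd_symAct_sub (i : b.support) (a : SymmetricAlgebra ℂ M) :
    lin (R.root i) ∣ symAct R (simpleReflection b i) a - a := by
  rw [← Ideal.mem_span_singleton, ← Ideal.Quotient.eq]
  have : (Ideal.Quotient.mkₐ ℂ (Ideal.span {lin (R.root i)})).comp
      (symAct R (simpleReflection b i)) = Ideal.Quotient.mkₐ ℂ (Ideal.span {lin (R.root i)}) := by
    refine SymmetricAlgebra.algHom_ext (LinearMap.ext fun x => ?_)
    change Ideal.Quotient.mk _ (symAct R _ (lin x)) = Ideal.Quotient.mk _ (lin x)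
    rw [symAct_lin, Ideal.Quotient.eq, simpleReflection, ofIdx_smul_eq, R.reflection_apply, lin,
      lin, map_sub, map_smul, sub_sub_cancel_left, neg_mem_iff]
    exact Submodule.smul_of_tower_mem _ _ (Ideal.mem_span_singleton_self _)
  exact DFunLike.congr_fun this a

lemma weylAct_simpleReflection (i : b.support) (p : Cosets b J → SymmetricAlgebra ℂ M)
    (x : Cosets b J) : weylAct b J (simpleReflection b i) p x =
      symAct R (simpleReflection b i) (p (simpleReflection b i • x)) := by
  rw [weylAct, simpleReflection_inv]

/-- The unspecified common degree is fixed by the nonzero value at `x`, a product of `ℓ(x)` linear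
forms. -/
lemma IsFlowUp.mem_homogeneousPart [Finite ι] {x : Cosets b J} {p : equivariantCohomology b J}
    (hp : IsFlowUp b J x p) (y : Cosets b J) :
    p.1 y ∈ homogeneousPart M (outLabels b J x).ncard := by
  obtain ⟨d, hd⟩ := hp.homogeneous
  have hx : p.1 x ≠ 0 := (hp.support x).mpr Relation.ReflTransGen.refl
  have h1 := symDegree_eq_of_mem (hd x) hx
  have h2 : p.1 x ∈ homogeneousPart M (outLabels b J x).ncard := by
    rw [hp.localization, finprod_mem_eq_finite_toFinset_prod _ (Set.toFinite _),
      Set.ncard_eq_toFinset_card _]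
    exact prod_lin_mem_homogeneousPart _ _
  rw [← symDegree_eq_of_mem h2 hx, h1]
  exact hd y

variable [R.IsReduced]

lemma eq_of_lin_root_dvd {α β : ι} (hα : b.IsPos α) (hβ : b.IsPos β)
    (h : lin (R.root α) ∣ lin (R.root β)) : α = β := by
  obtain ⟨c, hc⟩ := Submodule.mem_span_singleton.mp (mem_span_of_lin_dvd_lin h)
  by_contra hne
  have hneg : R.root α ≠ -R.root β := by
    intro h
    rw [← root_neg] at h
    rw [R.root.injective h, isPos_neg_iff] at hα
    exact hα hβ
  have := LinearIndependent.pair_iff.mp (RootPairing.IsReduced.linearIndependent R hne hneg) c (-1)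
    (by rw [hc]; simp)
  simp at this

variable [Finite ι] [R.IsCrystallographic] [R.IsRootSystem]

lemma dirEdge_simpleReflection_smul {x y : Cosets b J} {α : ι} {i : b.support}
    (h : DirEdge b J x α y) (hα : α ≠ i) :
    DirEdge b J (simpleReflection b i • x) (R.reflectionPerm i α)
      (simpleReflection b i • y) := by
  have hx : α ∈ outLabels b J x \ {(i : ι)} := ⟨⟨y, h⟩, hα⟩
  obtain ⟨hp, hneg⟩ := mem_outLabels_iff.mp (reflectionPerm_mem_outLabels hx).1
  refine dirEdge_iff.mpr ⟨hp, hneg, ?_⟩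
  rw [(dirEdge_iff.mp h).2.2, ofIdx_reflectionPerm, simpleReflection, ← mul_smul, ← mul_smul,
    mul_assoc _ _ (RootPairing.weylGroup.ofIdx R (i : ι)), ofIdx_mul_self, mul_one]

/-- The divided difference operator associated with a simple reflection. -/
lemma exists_dividedDifference (i : b.support) (p : equivariantCohomology b J) :
    ∃ g : equivariantCohomology b J, ∀ x,
      p.1 x - weylAct b J (simpleReflection b i) p.1 x = lin (R.root i) * g.1 x := by
  have hdvd : ∀ x, lin (R.root i) ∣ p.1 x - weylAct b J (simpleReflection b i) p.1 x := by
    intro x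
    rw [weylAct_simpleReflection]
    have h1 : lin (R.root i) ∣ p.1 x - p.1 (simpleReflection b i • x) := by
      by_cases hx : simpleReflection b i • x = x
      · simp [hx]
      · rcases dirEdge_or_dirEdge hx with h | h
        · exact Ideal.mem_span_singleton.mp (p.2 _ _ _ h)
        · rw [← neg_sub, dvd_neg]
          exact Ideal.mem_span_singleton.mp (p.2 _ _ _ h)
    have h2 := lin_root_dvd_symAct_sub i (p.1 (simpleReflection b i • x))
    simpa using dvd_sub h1 h2
  choose g hg using hdvd
  have hi : lin (R.root i) ≠ 0 := lin_ne_zero (R.ne_zero _)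
  refine ⟨⟨g, fun x y α h => Ideal.mem_span_singleton.mpr ?_⟩, hg⟩
  by_cases hα : α = i
  · subst hα
    have hy : y = simpleReflection b i • x := (dirEdge_iff.mp h).2.2
    -- `p - s_i p` and `α_i` both change sign under `s_i`, so the quotient `g` is `s_i`-invariant.
    have hgy : g y = symAct R (simpleReflection b i) (g x) := by
      apply mul_left_cancel₀ hi
      have e := congrArg (symAct R (simpleReflection b i)) (hg x)
      rw [weylAct_simpleReflection, map_sub, map_mul, symAct_simpleReflection_self,
        symAct_simpleReflection_lin_root, root_neg, lin, map_neg] at e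
      rw [← hg y, hy, weylAct_simpleReflection, simpleReflection_smul_smul]
      linear_combination -e
    rw [hgy, ← neg_sub, dvd_neg]
    exact lin_root_dvd_symAct_sub i _
  · have hp : Prime (lin (R.root α)) := prime_lin (R.ne_zero _)
    -- The edge with label `α` and its image under `s_i` show that `α` divides the difference of
    -- `α_i g`; being prime and not associate to `α_i`, it divides that of `g`.
    have hdiff : lin (R.root α) ∣ lin (R.root i) * (g x - g y) := by
      have h1 := Ideal.mem_span_singleton.mp (p.2 _ _ _ h)
      have h2 := map_dvd (symAct R (simpleReflection b i))
        (Ideal.mem_span_singleton.mp (p.2 _ _ _ (dirEdge_simpleReflection_smul h hα)))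
      rw [symAct_simpleReflection_lin_root, RootPairing.reflectionPerm_self, map_sub] at h2
      have h3 := dvd_sub h1 h2
      rw [mul_sub, ← hg, ← hg, weylAct_simpleReflection, weylAct_simpleReflection]
      convert h3 using 1
      ring
    refine (hp.dvd_or_dvd hdiff).resolve_left fun hd => hα ?_
    exact eq_of_lin_root_dvd (dirEdge_iff.mp h).1 (simple_isPos i) hd

/-- Vanishing at the far end of each edge makes each label divide `g x`; distinct positive roots are
non-associate primes, so their product divides too. -/
lemma prod_lin_dvd {g : equivariantCohomology b J} {x : Cosets b J}
    (h : ∀ y α, DirEdge b J x α y → g.1 y = 0) :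
    ∏ α ∈ (Set.toFinite (outLabels b J x)).toFinset, lin (R.root α) ∣ g.1 x := by
  classical
  have key : ∀ s : Finset ι, (∀ α ∈ s, α ∈ outLabels b J x) →
      ∏ α ∈ s, lin (R.root α) ∣ g.1 x := by
    intro s
    induction s using Finset.induction_on with
    | empty => simp
    | insert α s hα ih =>
      intro hs
      obtain ⟨c, hc⟩ := ih fun β hβ => hs β (Finset.mem_insert_of_mem hβ)
      obtain ⟨y, hy⟩ := hs α (Finset.mem_insert_self α s)
      have hd := Ideal.mem_span_singleton.mp (g.2 _ _ _ hy)
      have hp : Prime (lin (R.root α)) := prime_lin (R.ne_zero _)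
      rw [h y α hy, sub_zero, hc] at hd
      rcases hp.dvd_or_dvd hd with hd | hd
      · obtain ⟨β, hβ, hd⟩ := (hp.dvd_finsetProd_iff _).mp hd
        have := eq_of_lin_root_dvd (dirEdge_iff.mp hy).1
          (mem_outLabels_iff.mp (hs β (Finset.mem_insert_of_mem hβ))).1 hd
        exact absurd (this ▸ hβ) hα
      · rw [Finset.prod_insert hα, mul_comm, hc]
        exact mul_dvd_mul_left _ hd
  exact key _ fun α hα => by simpa using hα

/-- A class of degree less than `d` that is supported on vertices with at least `d` outgoing
edges vanishes. -/
lemma eq_zero_of_support {g : equivariantCohomology b J} {d : ℕ} {m : M} (hm : m ≠ 0)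
    (hd : ∀ x, lin m * g.1 x ∈ homogeneousPart M d)
    (hsupp : ∀ x, g.1 x ≠ 0 → d ≤ (outLabels b J x).ncard) (x : Cosets b J) : g.1 x = 0 := by
  generalize hn : (outLabels b J x).ncard = n
  induction n using Nat.strong_induction_on generalizing x with
  | _ n ih =>
    by_contra hx
    have hdvd := prod_lin_dvd (g := g) (x := x)
      fun y α h => ih _ (hn ▸ ncard_outLabels_lt h) y rfl
    obtain ⟨c, hc⟩ := hdvd
    have hne := hx
    rw [hc] at hne
    have h1 := symDegree_mul (left_ne_zero_of_mul hne) (right_ne_zero_of_mul hne)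
    rw [← hc, symDegree_eq_of_mem (prod_lin_mem_homogeneousPart _ _) (left_ne_zero_of_mul hne),
      ← Set.ncard_eq_toFinset_card] at h1
    -- The factor `lin m` accounts for one degree, so `g x` has degree exactly one less than `d`,
    -- while its divisor has degree at least `d`.
    have h2 := symDegree_mul (lin_ne_zero hm) hx
    rw [symDegree_lin hm, symDegree_eq_of_mem (hd x) (mul_ne_zero (lin_ne_zero hm) hx)] at h2
    have := hsupp x hx
    omega

/-! ### The two cases of the formula for flow-up classes. -/

namespace IsFlowUp

variable {x : Cosets b J} {p : equivariantCohomology b J}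

lemma eq_or_ncard_lt (hp : IsFlowUp b J x p) {y : Cosets b J} (hy : p.1 y ≠ 0) :
    x = y ∨ (outLabels b J x).ncard < (outLabels b J y).ncard :=
  ncard_outLabels_le ((hp.support y).mp hy)

/-- On vertices `y` other than `s_i x`, the class `s_i p_x` is supported in the same range as
`p_x`. -/
lemma ncard_le_of_weylAct_ne_zero (hp : IsFlowUp b J x p) {i : b.support} {y : Cosets b J}
    (hy : weylAct b J (simpleReflection b i) p.1 y ≠ 0) (hne : y ≠ simpleReflection b i • x) :
    (outLabels b J x).ncard ≤ (outLabels b J y).ncard := by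
  rw [weylAct_simpleReflection] at hy
  have hy' : p.1 (simpleReflection b i • y) ≠ 0 := fun h => hy (by rw [h, map_zero])
  rcases hp.eq_or_ncard_lt hy' with h | h
  · exact absurd (by rw [h, simpleReflection_smul_smul]) hne
  · have := ncard_outLabels_le_add_one (simpleReflection b i • y) i
    rw [simpleReflection_smul_smul] at this
    omega

lemma weylAct_eq_self (hp : IsFlowUp b J x p) {i : b.support}
    (h : ¬ DirEdge b J x i (simpleReflection b i • x)) :
    weylAct b J (simpleReflection b i) p.1 = p.1 := by
  obtain ⟨g, hg⟩ := exists_dividedDifference i p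
  have hle : (outLabels b J x).ncard ≤ (outLabels b J (simpleReflection b i • x)).ncard := by
    by_cases hx : simpleReflection b i • x = x
    · rw [hx]
    · exact (ncard_outLabels_lt ((dirEdge_or_dirEdge hx).resolve_left h)).le
  have h0 := eq_zero_of_support (g := g) (d := (outLabels b J x).ncard) (R.ne_zero i)
    (fun y => by
      rw [← hg, weylAct_simpleReflection]
      exact sub_mem (hp.mem_homogeneousPart _)
        (symAct_mem_homogeneousPart _ (hp.mem_homogeneousPart _)))
    (fun y hy => by
      -- The one vertex not covered by the support estimate; it is harmless because no edge descends
      -- from `x` to it.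
      by_cases hys : y = simpleReflection b i • x
      · rwa [hys]
      by_cases hpy : p.1 y = 0
      · refine hp.ncard_le_of_weylAct_ne_zero (i := i) (fun hw => ?_) hys
        have := hg y
        rw [hpy, hw, sub_zero] at this
        exact mul_ne_zero (lin_ne_zero (R.ne_zero _)) hy this.symm
      · rcases hp.eq_or_ncard_lt hpy with rfl | h
        · exact le_rfl
        · exact h.le)
  funext y
  have := hg y
  rw [h0, mul_zero, sub_eq_zero] at this
  exact this.symm

/-- `s_i` negates the label `α_i` of the edge out of `x` and carries the other outgoing labels to
those of `s_i x`. -/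
lemma weylAct_localization (hp : IsFlowUp b J x p) {i : b.support}
    (h : DirEdge b J x i (simpleReflection b i • x)) :
    weylAct b J (simpleReflection b i) p.1 (simpleReflection b i • x) =
      -(lin (R.root i) * ∏ᶠ α ∈ outLabels b J (simpleReflection b i • x), lin (R.root α)) := by
  have hi : (i : ι) ∉ outLabels b J (simpleReflection b i • x) := fun hi => by
    have h1 := (mem_outLabels_iff.mp hi).2
    rw [simpleReflection, cosetHeight_ofIdx_smul, R.reflection_apply_self, map_neg] at h1
    have := (dirEdge_iff.mp h).2.1
    linarith
  have hd : outLabels b J (simpleReflection b i • x) =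
      R.reflectionPerm i '' (outLabels b J x \ {(i : ι)}) := by
    rw [← outLabels_simpleReflection_smul, Set.sdiff_singleton_eq_self hi]
  have hx : outLabels b J x = insert (i : ι) (outLabels b J x \ {(i : ι)}) := by
    rw [Set.insert_sdiff_singleton, Set.insert_eq_of_mem (show (i : ι) ∈ outLabels b J x from ⟨_, h⟩)]
  rw [weylAct_simpleReflection, simpleReflection_smul_smul, hp.localization, hd,
    finprod_mem_image (Equiv.injective _).injOn, hx,
    finprod_mem_insert _ (by simp) (Set.toFinite _), Set.insert_sdiff_self_of_notMem (by simp),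
    map_mul, symAct_simpleReflection_lin_root, root_neg, lin, map_neg, neg_mul]
  congr 2
  refine (MonoidHom.map_finprod_mem _ ((symAct R (simpleReflection b i) :
    SymmetricAlgebra ℂ M →ₐ[ℂ] SymmetricAlgebra ℂ M) : SymmetricAlgebra ℂ M →* SymmetricAlgebra ℂ M)
    (Set.toFinite _)).trans ?_
  exact finprod_mem_congr rfl fun α _ => symAct_simpleReflection_lin_root i α

lemma weylAct_eq_sub (hp : IsFlowUp b J x p) {i : b.support}
    (h : DirEdge b J x i (simpleReflection b i • x)) {q : equivariantCohomology b J}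
    (hq : IsFlowUp b J (simpleReflection b i • x) q) (y : Cosets b J) :
    weylAct b J (simpleReflection b i) p.1 y = p.1 y - lin (R.root i) * q.1 y := by
  obtain ⟨g, hg⟩ := exists_dividedDifference i p
  have hlin : lin (R.root i) ≠ 0 := lin_ne_zero (R.ne_zero _)
  have hlt := ncard_outLabels_lt h
  have hcard : (outLabels b J x).ncard =
      1 + (outLabels b J (simpleReflection b i • x)).ncard := by
    have := ncard_outLabels_le_add_one x i
    omega
  have hgq : ∀ y, lin (R.root i) * (g - q).1 y =
      p.1 y - weylAct b J (simpleReflection b i) p.1 y - lin (R.root i) * q.1 y := by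
    intro y
    rw [hg, ← mul_sub]
    rfl
  have h0 := eq_zero_of_support (g := g - q) (d := (outLabels b J x).ncard) (R.ne_zero i)
    (fun y => by
      rw [hgq, weylAct_simpleReflection]
      refine sub_mem (sub_mem (hp.mem_homogeneousPart _)
        (symAct_mem_homogeneousPart _ (hp.mem_homogeneousPart _))) ?_
      rw [hcard]
      exact mul_mem_homogeneousPart (lin_mem_homogeneousPart _) (hq.mem_homogeneousPart _))
    (fun y hy => by
      by_cases hpy : p.1 y = 0
      · by_cases hys : y = simpleReflection b i • x
        -- Both localizations give `α_i` times the same product, so `g - q` vanishes at `s_i x`.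
        · refine absurd ?_ (mul_ne_zero hlin hy)
          rw [hgq, hpy, hys, hp.weylAct_localization h, hq.localization]
          ring
        by_cases hw : weylAct b J (simpleReflection b i) p.1 y = 0
        · have hqy : q.1 y ≠ 0 := fun hqy => mul_ne_zero hlin hy (by
            rw [hgq, hpy, hw, hqy]; ring)
          rcases hq.eq_or_ncard_lt hqy with h | h
          · exact absurd h.symm hys
          -- Having more outgoing edges than `s_i x` means having at least `ℓ(x)`, by `hcard`.
          · omega
        · exact hp.ncard_le_of_weylAct_ne_zero hw hys
      · rcases hp.eq_or_ncard_lt hpy with rfl | h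
        · exact le_rfl
        · exact h.le)
  have := hgq y
  rw [h0, mul_zero] at this
  linear_combination this

end IsFlowUp

end WeylAction

end

end FlagGKM

theorem mainTheorem2 {ι M N : Type*} [Finite ι] [AddCommGroup M] [Module ℂ M]
    [AddCommGroup N] [Module ℂ N] (R : RootPairing ι ℂ M N) [R.IsRootSystem]
    [R.IsCrystallographic] [R.IsReduced] (b : R.Base) (J : Set b.support) (i : b.support)
    (w : R.weylGroup) (p : FlagGKM.equivariantCohomology b J)
    (hp : FlagGKM.IsFlowUp b J (w : FlagGKM.Cosets b J) p) :
    (FlagGKM.BruhatLEP b J (w : FlagGKM.Cosets b J)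
        ((FlagGKM.simpleReflection b i * w : R.weylGroup) : FlagGKM.Cosets b J) →
      FlagGKM.weylAct b J (FlagGKM.simpleReflection b i) p.1 = p.1) ∧
    (FlagGKM.BruhatLTP b J
        ((FlagGKM.simpleReflection b i * w : R.weylGroup) : FlagGKM.Cosets b J)
        (w : FlagGKM.Cosets b J) →
      ∀ q : FlagGKM.equivariantCohomology b J,
        FlagGKM.IsFlowUp b J
          ((FlagGKM.simpleReflection b i * w : R.weylGroup) : FlagGKM.Cosets b J) q →
        FlagGKM.weylAct b J (FlagGKM.simpleReflection b i) p.1 =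
          p.1 - (FlagGKM.lin (R.root i) • q : FlagGKM.equivariantCohomology b J).1) := by
  have hsx : ((FlagGKM.simpleReflection b i * w : R.weylGroup) : FlagGKM.Cosets b J) =
      FlagGKM.simpleReflection b i • (w : FlagGKM.Cosets b J) := rfl
  rw [hsx]
  refine ⟨fun hle => hp.weylAct_eq_self fun h => FlagGKM.not_bruhatLEP_of_dirEdge h hle,
    fun hlt q hq => funext fun y => ?_⟩
  refine hp.weylAct_eq_sub ((FlagGKM.dirEdge_or_dirEdge hlt.2).resolve_right fun h => ?_) hq y
  exact FlagGKM.not_bruhatLEP_of_dirEdge h hlt.1
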